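/- Let $M$ be a 4-dimensional $C^\infty$ manifold and let $\mathcal F$ be a pseudo-Finsler function on $M$: a real function on $TM$ that, on an open conic set $\mathcal C\subseteq TM\setminus 0$ (for instance $\mathcal C=TM\setminus 0$, or a cone of timelike vectors), is smooth, positively homogeneous of degree 1, and has nondegenerate metric tensor $g_{ij}=\tfrac12\,\partial^2\mathcal F^2/\partial y^i\partial y^j$. Let $(x^i,y^i)$ be the coordinates on $TM$ induced by a chart of $M$; write ${}_{\cdot a}=\partial/\partial y^a$. Let $$G^i=\tfrac14 g^{ih}\Big(y^k\frac{\partial^2\mathcal F^2}{\partial x^k\partial y^h}-\frac{\partial\mathcal F^2}{\partial x^h}\Big)$$ be the coefficients in the geodesic equation $dy^i/ds+2G^i(x,y)=0$, $y=dx/ds$; let $N^a{}_j=G^a{}_{\cdot j}$ be the Cartan nonlinear connection, $f_{;i}=\partial f/\partial x^i-N^a{}_i f_{\cdot a}$, $\delta_i=\partial/\partial x^i-N^a{}_i\,\partial/\partial y^a$, $\delta y^a=dy^a+N^a{}_i\,dx^i$, and let $A_{j|i}=A_{j;i}-L^k{}_{ji}A_k$ be the Chern covariant derivative, where $L^i{}_{jk}=\tfrac12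 g^{ih}(g_{hj;k}+g_{hk;j}-g_{jk;h})$. Let $G$ be the determinant of the Sasaki lift $g_{ij}\,dx^i\otimes dx^j+g_{ij}\,\delta y^i\otimes\delta y^j$ and $d\Omega=dx^1\wedge\dots\wedge dx^4\wedge\delta y^1\wedge\dots\wedge\delta y^4$. Let $D\subseteq\mathcal C$ be an open set on which the coordinates $(x,y)$ are defined, let $A=A_i(x,y)\,dx^i$ be a smooth horizontal 1-form on $D$ (the potential), $J=J^i(x,y)\,\delta_i$ a smooth horizontal vector field on $D$, and $\alpha\neq0$, $\beta$ real constants. Put $F_{ij}=A_{j|i}-A_{i|j}$, $\tilde F_{ia}=-A_{i\cdot a}$, $F^{ij}=g^{ik}g^{jl}F_{kl}$, $\tilde F^{ia}=g^{ik}g^{ab}\tilde F_{kb}$, and suppose that the action integral $$I(A)=\int_D\big(\alpha(F_{ij}F^{ij}+2\tilde F_{ia}\tilde F^{ia})-\beta J^kA_k\big)\sqrt G\,d\Omega$$ converges absolutely. Then $A$ is stationary for $I$, that is, $\frac{d}{d\varepsilon}I(A+\varepsilon\,\delta A)\big|_{\varepsilon=0}=0$ for every smooth horizontal 1-form $\delta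 A=\delta A_i(x,y)\,dx^i$ with compact support in $D$, if and only if the generalized inhomogeneous Maxwell equation $$\frac1{\sqrt G}\Big\{(F^{ij}\sqrt G)_{;j}-F^{ij}N^a{}_{j\cdot a}\sqrt G\Big\}+\frac1{\sqrt G}(\tilde F^{ia}\sqrt G)_{\cdot a}=\frac{\beta}{4\alpha}J^i,\qquad i=1,\dots,4,$$ holds on $D$. (The term $\frac1{\sqrt G}(\tilde F^{ia}\sqrt G)_{\cdot a}$ is the extra current due to anisotropy.) -/

import Mathlib

open scoped Manifold ContDiff
open MeasureTheory

noncomputable section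

namespace FinslerEM

/-- The coordinate space of a four-dimensional manifold. -/
abbrev E4 : Type := EuclideanSpace ℝ (Fin 4)

/-- Coordinates `(x, y)` on the tangent bundle: `z.1 = x` are the base coordinates and `z.2 = y`
the fibre coordinates. -/
abbrev Coord : Type := E4 × E4

/-! ### Calculus in coordinates `(x, y)` -/

/-- `∂f/∂xⁱ`. -/
def dX (i : Fin 4) (f : Coord → ℝ) (z : Coord) : ℝ :=
  fderiv ℝ f z (EuclideanSpace.single i 1, 0)

/-- `∂f/∂yᵃ`, written `f_{·a}`. -/
def dY (a : Fin 4) (f : Coord → ℝ) (z : Coord) : ℝ :=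
  fderiv ℝ f z (0, EuclideanSpace.single a 1)

/-- The metric tensor `g_ij = ½ ∂²ℱ²/∂yⁱ∂yʲ` of a function `Φ = ℱ(x, y)`. -/
def metric (Φ : Coord → ℝ) (z : Coord) : Matrix (Fin 4) (Fin 4) ℝ :=
  Matrix.of fun i j => (1 / 2) * dY i (dY j (fun w => Φ w ^ 2)) z

/-- The inverse metric `g^{ij}`. -/
def metricInv (Φ : Coord → ℝ) (z : Coord) : Matrix (Fin 4) (Fin 4) ℝ :=
  (metric Φ z)⁻¹

/-- The coefficients `Gⁱ = ¼ g^{ih} (y^k ∂²ℱ²/∂x^k∂y^h - ∂ℱ²/∂x^h)` in the geodesic equation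
`dyⁱ/ds + 2 Gⁱ(x, y) = 0`, `y = dx/ds`. -/
def geodesicCoeff (Φ : Coord → ℝ) (i : Fin 4) (z : Coord) : ℝ :=
  (1 / 4) * ∑ h, metricInv Φ z i h *
    ((∑ k, z.2 k * dX k (dY h (fun w => Φ w ^ 2)) z) - dX h (fun w => Φ w ^ 2) z)

/-- The Cartan nonlinear connection `Nᵃ_j = ∂Gᵃ/∂yʲ`. -/
def cartanN (Φ : Coord → ℝ) (a j : Fin 4) (z : Coord) : ℝ :=
  dY j (geodesicCoeff Φ a) z

/-- The adapted derivative `f_{;i} = δ_i f = ∂f/∂xⁱ - Nᵃ_i ∂f/∂yᵃ`. -/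
def deltaX (Φ : Coord → ℝ) (i : Fin 4) (f : Coord → ℝ) (z : Coord) : ℝ :=
  dX i f z - ∑ a, cartanN Φ a i z * dY a f z

/-- The Chern connection coefficients
`Lⁱ_{jk} = ½ g^{ih} (g_{hj;k} + g_{hk;j} - g_{jk;h})`. -/
def chernL (Φ : Coord → ℝ) (i j k : Fin 4) (z : Coord) : ℝ :=
  (1 / 2) * ∑ h, metricInv Φ z i h *
    (deltaX Φ k (fun w => metric Φ w h j) z + deltaX Φ j (fun w => metric Φ w h k) z
      - deltaX Φ h (fun w => metric Φ w j k) z)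

/-- The horizontal Chern covariant derivative `A_{j|i} = δ_i A_j - Lᵏ_{ji} A_k` of a covector. -/
def covDeriv (Φ : Coord → ℝ) (A : Fin 4 → Coord → ℝ) (j i : Fin 4) (z : Coord) : ℝ :=
  deltaX Φ i (A j) z - ∑ k, chernL Φ k j i z * A k z

/-! ### The electromagnetic tensor and the action -/

/-- `F_ij = A_{j|i} - A_{i|j}`. -/
def emF (Φ : Coord → ℝ) (A : Fin 4 → Coord → ℝ) (i j : Fin 4) (z : Coord) : ℝ :=
  covDeriv Φ A j i z - covDeriv Φ A i j z

/-- `F̃_ia = - A_{i·a}`. -/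
def emFt (A : Fin 4 → Coord → ℝ) (i a : Fin 4) (z : Coord) : ℝ :=
  - dY a (A i) z

/-- `F^{ij} = g^{ik} g^{jl} F_kl`. -/
def emFUp (Φ : Coord → ℝ) (A : Fin 4 → Coord → ℝ) (i j : Fin 4) (z : Coord) : ℝ :=
  ∑ k, ∑ l, metricInv Φ z i k * metricInv Φ z j l * emF Φ A k l z

/-- `F̃^{ia} = g^{ik} g^{ab} F̃_kb`. -/
def emFtUp (Φ : Coord → ℝ) (A : Fin 4 → Coord → ℝ) (i a : Fin 4) (z : Coord) : ℝ :=
  ∑ k, ∑ b, metricInv Φ z i k * metricInv Φ z a b * emFt A k b z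

/-- The matrix of the Sasaki lift `g_ij dxⁱ ⊗ dxʲ + g_ij δyⁱ ⊗ δyʲ` in the adapted cobasis
`(dxⁱ, δyᵃ = dyᵃ + Nᵃ_i dxⁱ)`. -/
def sasaki (Φ : Coord → ℝ) (z : Coord) : Matrix (Fin 4 ⊕ Fin 4) (Fin 4 ⊕ Fin 4) ℝ :=
  Matrix.fromBlocks (metric Φ z) 0 0 (metric Φ z)

/-- `√G`, where `G` is the determinant of the Sasaki lift. -/
def sqrtG (Φ : Coord → ℝ) (z : Coord) : ℝ :=
  Real.sqrt (sasaki Φ z).det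

/-- The integrand `(α (F_ij F^{ij} + 2 F̃_ia F̃^{ia}) - β Jᵏ A_k) √G`. -/
def lagrangian (Φ : Coord → ℝ) (α β : ℝ) (J A : Fin 4 → Coord → ℝ) (z : Coord) : ℝ :=
  (α * ((∑ i, ∑ j, emF Φ A i j z * emFUp Φ A i j z)
      + 2 * ∑ i, ∑ a, emFt A i a z * emFtUp Φ A i a z)
    - β * ∑ k, J k z * A k z) * sqrtG Φ z

/-- The action `∫ (α (F_ij F^{ij} + 2 F̃_ia F̃^{ia}) - β Jᵏ A_k) √G dΩ` over a coordinate domain.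
Since `δyᵃ = dyᵃ + Nᵃ_i dxⁱ`, the volume element
`dΩ = dx¹ ∧ ⋯ ∧ dx⁴ ∧ δy¹ ∧ ⋯ ∧ δy⁴` equals `dx¹ ∧ ⋯ ∧ dx⁴ ∧ dy¹ ∧ ⋯ ∧ dy⁴`,
that is, Lebesgue measure in `(x, y)`. -/
def action (Φ : Coord → ℝ) (Ω : Set Coord) (α β : ℝ) (J A : Fin 4 → Coord → ℝ) : ℝ :=
  ∫ z in Ω, lagrangian Φ α β J A z

/-- The left-hand side
`(1/√G) {(F^{ij} √G)_{;j} - F^{ij} Nᵃ_{j·a} √G} + (1/√G) (F̃^{ia} √G)_{·a}`. -/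
def maxwellLHS (Φ : Coord → ℝ) (A : Fin 4 → Coord → ℝ) (i : Fin 4) (z : Coord) : ℝ :=
  1 / sqrtG Φ z *
      ((∑ j, deltaX Φ j (fun w => emFUp Φ A i j w * sqrtG Φ w) z)
        - ∑ j, ∑ a, emFUp Φ A i j z * dY a (cartanN Φ a j) z * sqrtG Φ z)
    + 1 / sqrtG Φ z * ∑ a, dY a (fun w => emFtUp Φ A i a w * sqrtG Φ w) z

/-! ### Pseudo-Finsler manifolds, fields on the tangent bundle -/

section Manifold

variable {M : Type*} [TopologicalSpace M] [ChartedSpace E4 M]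

/-- The tangent vector with coordinates `(x, y)` in the chart of `TM` induced by a chart `e`
of `M` (meaningful for `x ∈ e.target`). -/
def tangentPoint (e : OpenPartialHomeomorph M E4) (z : Coord) : TangentBundle (𝓡 4) M :=
  ⟨e.symm z.1, mfderiv (𝓡 4) (𝓡 4) e.symm z.1 z.2⟩

/-- The coordinate image of a set `D ⊆ TM` in the chart of `TM` induced by `e`. -/
def coordDomain (e : OpenPartialHomeomorph M E4) (D : Set (TangentBundle (𝓡 4) M)) : Set Coord :=
  {z | z.1 ∈ e.target ∧ tangentPoint e z ∈ D}

/-- The coordinate expression of a function on `TM`. -/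
def coordFun (e : OpenPartialHomeomorph M E4) (f : TangentBundle (𝓡 4) M → ℝ) (z : Coord) : ℝ :=
  f (tangentPoint e z)

variable (M) in
/-- A horizontal 1-form `A = A_i(x, y) dxⁱ` on `TM`: a covector on `M` at `π(v)` for each
`v ∈ TM`. -/
abbrev HorizontalForm : Type _ :=
  (v : TangentBundle (𝓡 4) M) → (TangentSpace (𝓡 4) v.proj →L[ℝ] ℝ)

variable (M) in
/-- A horizontal vector field `J = Jⁱ(x, y) δ_i` on `TM`, given by its projection
`Jⁱ(x, y) ∂/∂xⁱ ∈ T_{π(v)} M` for each `v ∈ TM`. -/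
abbrev HorizontalField : Type _ :=
  (v : TangentBundle (𝓡 4) M) → TangentSpace (𝓡 4) v.proj

/-- The components `A_i(x, y) = A(∂/∂xⁱ)` of a horizontal 1-form. -/
def formComp (e : OpenPartialHomeomorph M E4) (A : HorizontalForm M) (i : Fin 4) (z : Coord) : ℝ :=
  A (tangentPoint e z) (mfderiv (𝓡 4) (𝓡 4) e.symm z.1 (EuclideanSpace.single i 1 : E4))

/-- The components `Jⁱ(x, y) = dxⁱ(J)` of a horizontal vector field. -/
def fieldComp (e : OpenPartialHomeomorph M E4) (J : HorizontalField M) (i : Fin 4) (z : Coord) :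
    ℝ :=
  (EuclideanSpace.proj i : E4 →L[ℝ] ℝ)
    (mfderiv (𝓡 4) (𝓡 4) e (tangentPoint e z).proj (J (tangentPoint e z)))

variable (M) in
/-- A pseudo-Finsler function on `M`. It is smooth and positively homogeneous of degree one, with
nondegenerate metric tensor, on an open conic set of nonzero tangent vectors. The choice
`cone = TM ∖ 0` is the case of a function that is regular at all nonzero vectors; smaller cones
are needed for Lorentzian signature, where `ℱ` is not smooth on the light cone. -/
structure PseudoFinsler [IsManifold (𝓡 4) ∞ M] where
  /-- the function `ℱ` -/
  toFun : TangentBundle (𝓡 4) M → ℝ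
  /-- the set of vectors at which `ℱ` is regular -/
  cone : Set (TangentBundle (𝓡 4) M)
  isOpen_cone : IsOpen cone
  ne_zero : ∀ v ∈ cone, v.2 ≠ 0
  smul_mem : ∀ v ∈ cone, ∀ c : ℝ, 0 < c →
    (⟨v.proj, c • v.2⟩ : TangentBundle (𝓡 4) M) ∈ cone
  smooth : ContMDiffOn (𝓡 4).tangent 𝓘(ℝ, ℝ) ∞ toFun cone
  homogeneous : ∀ v ∈ cone, ∀ c : ℝ, 0 < c →
    toFun ⟨v.proj, c • v.2⟩ = c * toFun v
  nondegenerate : ∀ e ∈ IsManifold.maximalAtlas (𝓡 4) ∞ M, ∀ z ∈ coordDomain e cone,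
    (metric (coordFun e toFun) z).det ≠ 0

/-- A horizontal 1-form is smooth on `D`, for `D` contained in the domain of the chart of `TM`
induced by `e`. -/
def SmoothFormOn (e : OpenPartialHomeomorph M E4) (A : HorizontalForm M)
    (D : Set (TangentBundle (𝓡 4) M)) : Prop :=
  ∀ i, ContDiffOn ℝ ∞ (formComp e A i) (coordDomain e D)

/-- A horizontal vector field is smooth on `D`, for `D` contained in the domain of the chart of
`TM` induced by `e`. -/
def SmoothFieldOn (e : OpenPartialHomeomorph M E4) (J : HorizontalField M)
    (D : Set (TangentBundle (𝓡 4) M)) : Prop :=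
  ∀ i, ContDiffOn ℝ ∞ (fieldComp e J i) (coordDomain e D)

/-- The action of a potential `A` in the presence of the current `J`, on a domain `D` contained in
the domain of the chart of `TM` induced by `e`. -/
def emAction [IsManifold (𝓡 4) ∞ M] (ℱ : PseudoFinsler M) (e : OpenPartialHomeomorph M E4)
    (D : Set (TangentBundle (𝓡 4) M)) (α β : ℝ) (J : HorizontalField M) (A : HorizontalForm M) :
    ℝ :=
  action (coordFun e ℱ.toFun) (coordDomain e D) α β (fieldComp e J) (formComp e A)

/-- `A` is stationary for the action on `D`: the first variation vanishes for every smooth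
variation `η = δA` of the potential with compact support in `D`. -/
def IsStationary [IsManifold (𝓡 4) ∞ M] (ℱ : PseudoFinsler M) (e : OpenPartialHomeomorph M E4)
    (D : Set (TangentBundle (𝓡 4) M)) (α β : ℝ) (J : HorizontalField M) (A : HorizontalForm M) :
    Prop :=
  ∀ η : HorizontalForm M, SmoothFormOn e η D →
    (∃ K : Set (TangentBundle (𝓡 4) M), IsCompact K ∧ K ⊆ D ∧ ∀ v, v ∉ K → η v = 0) →
    HasDerivAt (fun ε : ℝ => emAction ℱ e D α β J (fun v => A v + ε • η v)) 0 0

end Manifold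

end FinslerEM

end

open scoped Manifold ContDiff
open MeasureTheory

noncomputable section

namespace FinslerEM


/-! ### Calculus in coordinates and integration of compactly supported derivatives -/

section Calculus

variable {Ω K : Set Coord} {f g : Coord → ℝ} {z : Coord}

/-! In the chart of $TM$ induced by `e` the problem becomes one on an open subset of $\mathbb R^8$
with Lebesgue measure. The Lagrangian is quadratic in the potential, so $I(A+\varepsilon\eta)$ is
exactly a quadratic polynomial in $\varepsilon$ (`lagrangian_add_const_mul`), and its linear
coefficient is the derivative at $0$; no differentiation under the integral sign is needed.

That coefficient is integrated by parts. Since the Chern coefficients are symmetric,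
$F_{ij}=\delta_iA_j-\delta_jA_i$ (`emF_eq`). The operator
$\delta_j=\partial_{x^j}-N^a{}_j\partial_{y^a}$ is not divergence-free, and moving it off $\eta$
leaves the term with $N^a{}_{j\cdot a}$ (`mul_deltaX_eq`). Hence the first variation is
$\sum_i\eta_iE_i$ plus total derivatives (`firstVariation_eq`), and the latter integrate to zero
because $\eta$ has compact support (`setIntegral_fderiv_eq_zero`).

Here $E_i$ is $4\alpha\sqrt G$ times the difference of the two sides of Maxwell's equation, and
$G=(\det g)^2>0$. So Maxwell's equation gives stationarity at once; conversely, testing with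
$\eta=\varphi\,dx^i$ (`coordForm`) and applying the fundamental lemma of the calculus of variations
gives $E_i=0$. -/

theorem contDiffOn_fderiv_apply (hΩ : IsOpen Ω) (hf : ContDiffOn ℝ ∞ f Ω) (v : Coord) :
    ContDiffOn ℝ ∞ (fun w => fderiv ℝ f w v) Ω :=
  (hf.fderiv_of_isOpen hΩ (by simp)).clm_apply contDiffOn_const

theorem contDiffOn_dX (hΩ : IsOpen Ω) (hf : ContDiffOn ℝ ∞ f Ω) (i : Fin 4) :
    ContDiffOn ℝ ∞ (dX i f) Ω := contDiffOn_fderiv_apply hΩ hf _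

theorem contDiffOn_dY (hΩ : IsOpen Ω) (hf : ContDiffOn ℝ ∞ f Ω) (a : Fin 4) :
    ContDiffOn ℝ ∞ (dY a f) Ω := contDiffOn_fderiv_apply hΩ hf _

theorem differentiableAt_of_contDiffOn (hΩ : IsOpen Ω) (hf : ContDiffOn ℝ ∞ f Ω) (hz : z ∈ Ω) :
    DifferentiableAt ℝ f z :=
  (hf.contDiffAt (hΩ.mem_nhds hz)).differentiableAt (by simp)

theorem dX_add (i : Fin 4) (hf : DifferentiableAt ℝ f z) (hg : DifferentiableAt ℝ g z) :
    dX i (fun w => f w + g w) z = dX i f z + dX i g z := by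
  simp [dX, fderiv_fun_add hf hg]

theorem dY_add (a : Fin 4) (hf : DifferentiableAt ℝ f z) (hg : DifferentiableAt ℝ g z) :
    dY a (fun w => f w + g w) z = dY a f z + dY a g z := by
  simp [dY, fderiv_fun_add hf hg]

theorem dX_const_mul (i : Fin 4) (c : ℝ) (hf : DifferentiableAt ℝ f z) :
    dX i (fun w => c * f w) z = c * dX i f z := by
  simp [dX, fderiv_const_mul hf]

theorem dY_const_mul (a : Fin 4) (c : ℝ) (hf : DifferentiableAt ℝ f z) :
    dY a (fun w => c * f w) z = c * dY a f z := by
  simp [dY, fderiv_const_mul hf]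

theorem dX_mul (i : Fin 4) (hf : DifferentiableAt ℝ f z) (hg : DifferentiableAt ℝ g z) :
    dX i (fun w => f w * g w) z = dX i f z * g z + f z * dX i g z := by
  simp [dX, fderiv_fun_mul hf hg]; ring

theorem dY_mul (a : Fin 4) (hf : DifferentiableAt ℝ f z) (hg : DifferentiableAt ℝ g z) :
    dY a (fun w => f w * g w) z = dY a f z * g z + f z * dY a g z := by
  simp [dY, fderiv_fun_mul hf hg]; ring

theorem dY_comm (hΩ : IsOpen Ω) (hf : ContDiffOn ℝ ∞ f Ω) (hz : z ∈ Ω) (a b : Fin 4) :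
    dY a (dY b f) z = dY b (dY a f) z := by
  have hs : IsSymmSndFDerivAt ℝ f z :=
    (hf.contDiffAt (hΩ.mem_nhds hz)).isSymmSndFDerivAt (by
      simp only [minSmoothness_of_isRCLikeNormedField]; exact WithTop.coe_le_coe.2 le_top)
  have hd : DifferentiableAt ℝ (fderiv ℝ f) z :=
    ((hf.fderiv_of_isOpen (m := ∞) hΩ (by simp)).contDiffAt (hΩ.mem_nhds hz)).differentiableAt
      (by simp)
  have key : ∀ v w : Coord, fderiv ℝ (fun u => fderiv ℝ f u v) z w
      = fderiv ℝ (fderiv ℝ f) z w v := by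
    intro v w
    rw [fderiv_clm_apply hd (differentiableAt_const v)]
    simp
  change fderiv ℝ (fun u => fderiv ℝ f u _) z _ = fderiv ℝ (fun u => fderiv ℝ f u _) z _
  rw [key, key]
  exact hs _ _

/-- A function that is continuous on an open set and vanishes there off a compact subset is
integrable. -/
theorem integrableOn_of_eq_zero_off_compact (hΩ : IsOpen Ω) (hf : ContinuousOn f Ω)
    (hK : IsCompact K) (hKΩ : K ⊆ Ω) (h0 : ∀ w ∈ Ω, w ∉ K → f w = 0) : IntegrableOn f Ω :=
  ((hf.mono hKΩ).integrableOn_compact hK).of_forall_sdiff_eq_zero hΩ.measurableSet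
    fun w hw => h0 w hw.1 hw.2

/-- A compact subset of `Coord` is closed, so the function vanishes on a whole neighbourhood of the
point. -/
theorem fderiv_eq_zero_off_compact (hΩ : IsOpen Ω) (hK : IsCompact K)
    (h0 : ∀ w ∈ Ω, w ∉ K → f w = 0) (hz : z ∈ Ω) (hzK : z ∉ K) : fderiv ℝ f z = 0 := by
  have : f =ᶠ[nhds z] fun _ => (0 : ℝ) := by
    filter_upwards [(hΩ.sdiff hK.isClosed).mem_nhds ⟨hz, hzK⟩] with w hw
    exact h0 w hw.1 hw.2
  rw [this.fderiv_eq]; simp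

/-- The integral of a derivative of a function with compact support in an open set vanishes. -/
theorem setIntegral_fderiv_eq_zero (hΩ : IsOpen Ω) (hf : ContDiffOn ℝ ∞ f Ω)
    (hK : IsCompact K) (hKΩ : K ⊆ Ω) (h0 : ∀ w ∈ Ω, w ∉ K → f w = 0) (v : Coord) :
    ∫ w in Ω, fderiv ℝ f w v = 0 := by
  have : (volume : Measure Coord).IsAddHaarMeasure :=
    Measure.prod.instIsAddHaarMeasure (volume : Measure E4) (volume : Measure E4)
  -- Extension by zero: it agrees with `f` on `Ω` and vanishes on the open set `Kᶜ`. These two open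
  -- sets cover the space, so the extension is smooth everywhere.
  set h : Coord → ℝ := Ω.indicator f with hh
  have hoff : ∀ w ∉ K, h w = 0 := fun w hw => by
    by_cases hw' : w ∈ Ω
    · rw [hh, Set.indicator_of_mem hw', h0 w hw' hw]
    · rw [hh, Set.indicator_of_notMem hw']
  have heq : ∀ w ∈ Ω, h =ᶠ[nhds w] f := fun w hw => by
    filter_upwards [hΩ.mem_nhds hw] with u hu using Set.indicator_of_mem hu f
  have hsmooth : ContDiff ℝ ∞ h := contDiff_iff_contDiffAt.2 fun w => by
    by_cases hw : w ∈ Ω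
    · exact (hf.contDiffAt (hΩ.mem_nhds hw)).congr_of_eventuallyEq (heq w hw)
    · have : h =ᶠ[nhds w] fun _ => (0 : ℝ) := by
        filter_upwards [hK.isClosed.isOpen_compl.mem_nhds fun hwK => hw (hKΩ hwK)] with u hu
        exact hoff u hu
      exact contDiffAt_const.congr_of_eventuallyEq this
  have hsupp : HasCompactSupport h := HasCompactSupport.intro hK hoff
  have hderiv : Continuous fun w => fderiv ℝ h w v :=
    (hsmooth.continuous_fderiv (by simp)).clm_apply continuous_const
  have hderiv_supp : HasCompactSupport fun w => fderiv ℝ h w v :=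
    hsupp.fderiv_apply (𝕜 := ℝ) v
  have hint : ∫ w, fderiv ℝ h w v = 0 := by
    -- Integration by parts against the constant function `1`.
    have := integral_bilinear_hasLineDerivAt_right_eq_neg_left_of_integrable
      (μ := (volume : Measure Coord)) (f := fun _ : Coord => (1 : ℝ)) (f' := fun _ => 0)
      (g := h) (g' := fun w => fderiv ℝ h w v) (v := v) (B := ContinuousLinearMap.mul ℝ ℝ)
      (by simp)
      (by simpa using hderiv.integrable_of_hasCompactSupport hderiv_supp)
      (by simpa using hsmooth.continuous.integrable_of_hasCompactSupport hsupp)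
      (fun w _ => by simpa using (hasFDerivAt_const (1 : ℝ) w).hasLineDerivAt v)
      (fun w _ => ((hsmooth.differentiable (by simp)) w).hasFDerivAt.hasLineDerivAt v)
    simpa using this
  calc ∫ w in Ω, fderiv ℝ f w v = ∫ w in Ω, fderiv ℝ h w v :=
        setIntegral_congr_fun hΩ.measurableSet fun w hw => by
          simp only [(heq w hw).fderiv_eq]
    _ = ∫ w, fderiv ℝ h w v := setIntegral_eq_integral_of_forall_compl_eq_zero fun w hw => by
        rw [fderiv_eq_zero_off_compact (f := h) isOpen_univ hK (fun u _ hu => hoff u hu) trivial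
          fun hwK => hw (hKΩ hwK)]
        rfl
    _ = 0 := hint

end Calculus


/-! ### Smoothness and symmetries of the Finsler geometry and the field tensors -/

section Geometry

variable {Ω K : Set Coord} {Φ : Coord → ℝ} {z : Coord} {A B : Fin 4 → Coord → ℝ}

theorem contDiffOn_metric (hΩ : IsOpen Ω) (hΦ : ContDiffOn ℝ ∞ Φ Ω) (i j : Fin 4) :
    ContDiffOn ℝ ∞ (fun w => metric Φ w i j) Ω :=
  contDiffOn_const.mul (contDiffOn_dY hΩ (contDiffOn_dY hΩ (hΦ.pow 2) j) i)

theorem metric_symm (hΩ : IsOpen Ω) (hΦ : ContDiffOn ℝ ∞ Φ Ω) (hz : z ∈ Ω) (i j : Fin 4) :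
    metric Φ z i j = metric Φ z j i := by
  simp only [metric, Matrix.of_apply]
  rw [dY_comm hΩ (hΦ.pow 2) hz]

theorem metricInv_symm (hΩ : IsOpen Ω) (hΦ : ContDiffOn ℝ ∞ Φ Ω) (hz : z ∈ Ω) (i j : Fin 4) :
    metricInv Φ z i j = metricInv Φ z j i := by
  have h : (metric Φ z).transpose = metric Φ z := by
    ext k l; exact metric_symm hΩ hΦ hz l k
  have h' : (metricInv Φ z).transpose = metricInv Φ z := by
    rw [metricInv, Matrix.transpose_nonsing_inv, h]
  exact congrFun (congrFun h' j) i

theorem contDiffOn_det {n : Type*} [Fintype n] [DecidableEq n]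
    {m : Coord → Matrix n n ℝ} (hm : ∀ i j, ContDiffOn ℝ ∞ (fun w => m w i j) Ω) :
    ContDiffOn ℝ ∞ (fun w => (m w).det) Ω := by
  simp only [Matrix.det_apply']
  exact ContDiffOn.sum fun σ _ => contDiffOn_const.mul (contDiffOn_prod fun i _ => hm _ _)

/-- Cramer's rule: adjugate entries are determinants in the metric components, divided by the
nonvanishing `det g`. -/
theorem contDiffOn_metricInv (hΩ : IsOpen Ω) (hΦ : ContDiffOn ℝ ∞ Φ Ω)
    (hdet : ∀ w ∈ Ω, (metric Φ w).det ≠ 0) (i j : Fin 4) :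
    ContDiffOn ℝ ∞ (fun w => metricInv Φ w i j) Ω := by
  simp only [metricInv, Matrix.inv_def, Matrix.smul_apply, Matrix.adjugate_apply,
    Ring.inverse_eq_inv', smul_eq_mul]
  refine ((contDiffOn_det (contDiffOn_metric hΩ hΦ)).inv hdet).mul (contDiffOn_det fun k l => ?_)
  by_cases hk : k = j
  · subst hk; simpa using contDiffOn_const
  · simpa [Matrix.updateRow_ne hk] using contDiffOn_metric hΩ hΦ k l

theorem contDiffOn_geodesicCoeff (hΩ : IsOpen Ω) (hΦ : ContDiffOn ℝ ∞ Φ Ω)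
    (hdet : ∀ w ∈ Ω, (metric Φ w).det ≠ 0) (i : Fin 4) :
    ContDiffOn ℝ ∞ (geodesicCoeff Φ i) Ω := by
  have hy : ∀ k : Fin 4, ContDiffOn ℝ ∞ (fun w : Coord => w.2 k) Ω := fun k =>
    ((EuclideanSpace.proj k : E4 →L[ℝ] ℝ).contDiff.comp contDiff_snd).contDiffOn
  exact contDiffOn_const.mul (ContDiffOn.sum fun h _ => (contDiffOn_metricInv hΩ hΦ hdet i h).mul
    ((ContDiffOn.sum fun k _ => (hy k).mul
      (contDiffOn_dX hΩ (contDiffOn_dY hΩ (hΦ.pow 2) h) k)).sub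
      (contDiffOn_dX hΩ (hΦ.pow 2) h)))

theorem contDiffOn_cartanN (hΩ : IsOpen Ω) (hΦ : ContDiffOn ℝ ∞ Φ Ω)
    (hdet : ∀ w ∈ Ω, (metric Φ w).det ≠ 0) (a j : Fin 4) :
    ContDiffOn ℝ ∞ (cartanN Φ a j) Ω :=
  contDiffOn_dY hΩ (contDiffOn_geodesicCoeff hΩ hΦ hdet a) j

theorem contDiffOn_deltaX (hΩ : IsOpen Ω) (hΦ : ContDiffOn ℝ ∞ Φ Ω)
    (hdet : ∀ w ∈ Ω, (metric Φ w).det ≠ 0) {f : Coord → ℝ} (hf : ContDiffOn ℝ ∞ f Ω)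
    (i : Fin 4) : ContDiffOn ℝ ∞ (deltaX Φ i f) Ω :=
  (contDiffOn_dX hΩ hf i).sub (ContDiffOn.sum fun a _ =>
    (contDiffOn_cartanN hΩ hΦ hdet a i).mul (contDiffOn_dY hΩ hf a))

theorem deltaX_congr {f g : Coord → ℝ} (h : f =ᶠ[nhds z] g) (i : Fin 4) :
    deltaX Φ i f z = deltaX Φ i g z := by
  simp only [deltaX, dX, dY, h.fderiv_eq]

theorem deltaX_add_const_mul {f g : Coord → ℝ} (hf : DifferentiableAt ℝ f z)
    (hg : DifferentiableAt ℝ g z) (c : ℝ) (i : Fin 4) :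
    deltaX Φ i (fun w => f w + c * g w) z = deltaX Φ i f z + c * deltaX Φ i g z := by
  have hcg : DifferentiableAt ℝ (fun w => c * g w) z := hg.const_mul c
  simp only [deltaX, dX_add i hf hcg, dY_add _ hf hcg, dX_const_mul i c hg, dY_const_mul _ c hg,
    mul_sub, Finset.mul_sum, mul_add, Finset.sum_add_distrib]
  simp only [mul_left_comm c]
  ring

/-- The Chern connection is torsion-free. -/
theorem chernL_symm (hΩ : IsOpen Ω) (hΦ : ContDiffOn ℝ ∞ Φ Ω) (hz : z ∈ Ω) (i j k : Fin 4) :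
    chernL Φ i j k z = chernL Φ i k j z := by
  -- The metric is known to be symmetric only on `Ω`; equality of germs is what allows it to be
  -- differentiated.
  have h : ∀ l m, (fun w => metric Φ w l m) =ᶠ[nhds z] fun w => metric Φ w m l := fun l m => by
    filter_upwards [hΩ.mem_nhds hz] with w hw using metric_symm hΩ hΦ hw l m
  simp only [chernL]
  congr 1
  refine Finset.sum_congr rfl fun l _ => ?_
  rw [deltaX_congr (h j k)]
  ring

/-- In `F_ij` the Chern coefficients drop out. -/
theorem emF_eq (hΩ : IsOpen Ω) (hΦ : ContDiffOn ℝ ∞ Φ Ω) (hz : z ∈ Ω) (i j : Fin 4) :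
    emF Φ A i j z = deltaX Φ i (A j) z - deltaX Φ j (A i) z := by
  simp only [emF, covDeriv, chernL_symm hΩ hΦ hz _ j i]
  ring

theorem emFUp_antisymm (i j : Fin 4) : emFUp Φ A i j z = - emFUp Φ A j i z := by
  simp only [emFUp]
  rw [Finset.sum_comm]
  simp only [← Finset.sum_neg_distrib]
  refine Finset.sum_congr rfl fun k _ => Finset.sum_congr rfl fun l _ => ?_
  simp only [emF]
  ring

theorem contDiffOn_emF (hΩ : IsOpen Ω) (hΦ : ContDiffOn ℝ ∞ Φ Ω)
    (hdet : ∀ w ∈ Ω, (metric Φ w).det ≠ 0) (hA : ∀ i, ContDiffOn ℝ ∞ (A i) Ω) (i j : Fin 4) :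
    ContDiffOn ℝ ∞ (emF Φ A i j) Ω :=
  ((contDiffOn_deltaX hΩ hΦ hdet (hA j) i).sub (contDiffOn_deltaX hΩ hΦ hdet (hA i) j)).congr
    fun _ hw => emF_eq hΩ hΦ hw i j

theorem contDiffOn_emFt (hΩ : IsOpen Ω) (hA : ∀ i, ContDiffOn ℝ ∞ (A i) Ω) (i a : Fin 4) :
    ContDiffOn ℝ ∞ (emFt A i a) Ω := (contDiffOn_dY hΩ (hA i) a).neg

theorem contDiffOn_emFUp (hΩ : IsOpen Ω) (hΦ : ContDiffOn ℝ ∞ Φ Ω)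
    (hdet : ∀ w ∈ Ω, (metric Φ w).det ≠ 0) (hA : ∀ i, ContDiffOn ℝ ∞ (A i) Ω) (i j : Fin 4) :
    ContDiffOn ℝ ∞ (emFUp Φ A i j) Ω :=
  ContDiffOn.sum fun k _ => ContDiffOn.sum fun l _ =>
    ((contDiffOn_metricInv hΩ hΦ hdet i k).mul (contDiffOn_metricInv hΩ hΦ hdet j l)).mul
      (contDiffOn_emF hΩ hΦ hdet hA k l)

theorem contDiffOn_emFtUp (hΩ : IsOpen Ω) (hΦ : ContDiffOn ℝ ∞ Φ Ω)
    (hdet : ∀ w ∈ Ω, (metric Φ w).det ≠ 0) (hA : ∀ i, ContDiffOn ℝ ∞ (A i) Ω) (i a : Fin 4) :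
    ContDiffOn ℝ ∞ (emFtUp Φ A i a) Ω :=
  ContDiffOn.sum fun k _ => ContDiffOn.sum fun b _ =>
    ((contDiffOn_metricInv hΩ hΦ hdet i k).mul (contDiffOn_metricInv hΩ hΦ hdet a b)).mul
      (contDiffOn_emFt hΩ hA k b)

theorem det_sasaki : (sasaki Φ z).det = (metric Φ z).det * (metric Φ z).det := by
  rw [sasaki, Matrix.det_fromBlocks_zero₂₁]

/-- The Sasaki determinant is the square of `det g`, hence positive in every signature. -/
theorem sqrtG_pos (h : (metric Φ z).det ≠ 0) : 0 < sqrtG Φ z := by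
  rw [sqrtG, det_sasaki]
  exact Real.sqrt_pos.2 (mul_self_pos.2 h)

theorem contDiffOn_sqrtG (hΩ : IsOpen Ω) (hΦ : ContDiffOn ℝ ∞ Φ Ω)
    (hdet : ∀ w ∈ Ω, (metric Φ w).det ≠ 0) : ContDiffOn ℝ ∞ (sqrtG Φ) Ω := by
  have hd := contDiffOn_det (contDiffOn_metric hΩ hΦ)
  refine ((hd.mul hd).sqrt fun w hw => mul_self_ne_zero.2 (hdet w hw)).congr fun w _ => ?_
  rw [sqrtG, det_sasaki]

/-! ### The quadratic form of the Lagrangian -/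

/-- The symmetric bilinear form polarizing `F_ij F^{ij} + 2 F̃_ia F̃^{ia}`. -/
def emPairing (Φ : Coord → ℝ) (A B : Fin 4 → Coord → ℝ) (z : Coord) : ℝ :=
  (∑ i, ∑ j, emF Φ A i j z * emFUp Φ B i j z) + 2 * ∑ i, ∑ a, emFt A i a z * emFtUp Φ B i a z

/-- Exchanging the index pair $(i,j)$ with $(k,l)$. It serves the horizontal and the vertical part
of the pairing alike, both being raised with the same inverse metric. -/
theorem sum_raise_symm {u : Matrix (Fin 4) (Fin 4) ℝ} (hu : ∀ i j, u i j = u j i)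
    (S T : Fin 4 → Fin 4 → ℝ) :
    ∑ i, ∑ j, S i j * ∑ k, ∑ l, u i k * u j l * T k l
      = ∑ i, ∑ j, T i j * ∑ k, ∑ l, u i k * u j l * S k l := by
  have hcomm : ∀ f : Fin 4 → Fin 4 → Fin 4 → Fin 4 → ℝ,
      ∑ i, ∑ j, ∑ k, ∑ l, f i j k l = ∑ k, ∑ l, ∑ i, ∑ j, f i j k l := fun f => by
    have := Finset.sum_comm (s := Finset.univ) (t := Finset.univ)
      (f := fun (p q : Fin 4 × Fin 4) => f p.1 p.2 q.1 q.2)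
    simpa only [Fintype.sum_prod_type] using this
  simp only [Finset.mul_sum]
  rw [hcomm]
  refine Finset.sum_congr rfl fun i _ => Finset.sum_congr rfl fun j _ =>
    Finset.sum_congr rfl fun k _ => Finset.sum_congr rfl fun l _ => ?_
  rw [hu k i, hu l j]
  ring

theorem emPairing_symm (hΩ : IsOpen Ω) (hΦ : ContDiffOn ℝ ∞ Φ Ω) (hz : z ∈ Ω) :
    emPairing Φ A B z = emPairing Φ B A z := by
  simp only [emPairing, emFUp, emFtUp]
  rw [sum_raise_symm (metricInv_symm hΩ hΦ hz) (fun i j => emF Φ A i j z),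
    sum_raise_symm (metricInv_symm hΩ hΦ hz) (fun i j => emFt A i j z)]

theorem contDiffOn_emPairing (hΩ : IsOpen Ω) (hΦ : ContDiffOn ℝ ∞ Φ Ω)
    (hdet : ∀ w ∈ Ω, (metric Φ w).det ≠ 0) (hA : ∀ i, ContDiffOn ℝ ∞ (A i) Ω)
    (hB : ∀ i, ContDiffOn ℝ ∞ (B i) Ω) : ContDiffOn ℝ ∞ (emPairing Φ A B) Ω :=
  (ContDiffOn.sum fun i _ => ContDiffOn.sum fun j _ =>
    (contDiffOn_emF hΩ hΦ hdet hA i j).mul (contDiffOn_emFUp hΩ hΦ hdet hB i j)).add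
  (contDiffOn_const.mul (ContDiffOn.sum fun i _ => ContDiffOn.sum fun a _ =>
    (contDiffOn_emFt hΩ hA i a).mul (contDiffOn_emFtUp hΩ hΦ hdet hB i a)))

theorem emF_add_const_mul (hΩ : IsOpen Ω) (hΦ : ContDiffOn ℝ ∞ Φ Ω)
    (hA : ∀ i, ContDiffOn ℝ ∞ (A i) Ω) (hB : ∀ i, ContDiffOn ℝ ∞ (B i) Ω) (hz : z ∈ Ω)
    (c : ℝ) (i j : Fin 4) :
    emF Φ (fun k w => A k w + c * B k w) i j z = emF Φ A i j z + c * emF Φ B i j z := by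
  have dA := fun k => differentiableAt_of_contDiffOn hΩ (hA k) hz
  have dB := fun k => differentiableAt_of_contDiffOn hΩ (hB k) hz
  simp only [emF_eq hΩ hΦ hz, deltaX_add_const_mul (dA _) (dB _)]
  ring

theorem emFt_add_const_mul (hΩ : IsOpen Ω)
    (hA : ∀ i, ContDiffOn ℝ ∞ (A i) Ω) (hB : ∀ i, ContDiffOn ℝ ∞ (B i) Ω) (hz : z ∈ Ω)
    (c : ℝ) (i a : Fin 4) :
    emFt (fun k w => A k w + c * B k w) i a z = emFt A i a z + c * emFt B i a z := by
  have dA := fun k => differentiableAt_of_contDiffOn hΩ (hA k) hz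
  have dB := fun k => differentiableAt_of_contDiffOn hΩ (hB k) hz
  simp only [emFt, dY_add _ (dA i) ((dB i).const_mul c), dY_const_mul _ c (dB i)]
  ring

theorem emPairing_add_left (hΩ : IsOpen Ω) (hΦ : ContDiffOn ℝ ∞ Φ Ω)
    (hA : ∀ i, ContDiffOn ℝ ∞ (A i) Ω) (hB : ∀ i, ContDiffOn ℝ ∞ (B i) Ω) (hz : z ∈ Ω)
    (c : ℝ) (C : Fin 4 → Coord → ℝ) :
    emPairing Φ (fun k w => A k w + c * B k w) C z
      = emPairing Φ A C z + c * emPairing Φ B C z := by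
  simp only [emPairing, emF_add_const_mul hΩ hΦ hA hB hz, emFt_add_const_mul hΩ hA hB hz,
    add_mul, Finset.sum_add_distrib, mul_assoc, ← Finset.mul_sum]
  ring

theorem emPairing_add_right (hΩ : IsOpen Ω) (hΦ : ContDiffOn ℝ ∞ Φ Ω)
    (hA : ∀ i, ContDiffOn ℝ ∞ (A i) Ω) (hB : ∀ i, ContDiffOn ℝ ∞ (B i) Ω) (hz : z ∈ Ω)
    (c : ℝ) (C : Fin 4 → Coord → ℝ) :
    emPairing Φ C (fun k w => A k w + c * B k w) z
      = emPairing Φ C A z + c * emPairing Φ C B z := by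
  rw [emPairing_symm hΩ hΦ hz, emPairing_add_left hΩ hΦ hA hB hz,
    emPairing_symm hΩ hΦ hz (A := A), emPairing_symm hΩ hΦ hz (A := B)]

theorem emPairing_eq_zero_off_compact (hΩ : IsOpen Ω) (hΦ : ContDiffOn ℝ ∞ Φ Ω)
    (hK : IsCompact K) (h0 : ∀ i, ∀ w ∈ Ω, w ∉ K → A i w = 0) (hz : z ∈ Ω) (hzK : z ∉ K) :
    emPairing Φ A B z = 0 := by
  have hd := fun i => fderiv_eq_zero_off_compact hΩ hK (h0 i) hz hzK
  have hF : ∀ i j, emF Φ A i j z = 0 := fun i j => by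
    rw [emF_eq hΩ hΦ hz]; simp [deltaX, dX, dY, hd]
  have hFt : ∀ i a, emFt A i a z = 0 := fun i a => by simp [emFt, dY, hd]
  simp [emPairing, hF, hFt]

theorem lagrangian_eq (α β : ℝ) (J : Fin 4 → Coord → ℝ) :
    lagrangian Φ α β J A z
      = (α * emPairing Φ A A z - β * ∑ k, J k z * A k z) * sqrtG Φ z := rfl

/-- The density of the first variation of the action. -/
def firstVariation (Φ : Coord → ℝ) (α β : ℝ) (J A η : Fin 4 → Coord → ℝ) (z : Coord) : ℝ :=
  (2 * α * emPairing Φ η A z - β * ∑ k, J k z * η k z) * sqrtG Φ z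

theorem lagrangian_add_const_mul (hΩ : IsOpen Ω) (hΦ : ContDiffOn ℝ ∞ Φ Ω)
    (hA : ∀ i, ContDiffOn ℝ ∞ (A i) Ω) (hB : ∀ i, ContDiffOn ℝ ∞ (B i) Ω) (hz : z ∈ Ω)
    (α β : ℝ) (J : Fin 4 → Coord → ℝ) (ε : ℝ) :
    lagrangian Φ α β J (fun k w => A k w + ε * B k w) z
      = lagrangian Φ α β J A z + ε * firstVariation Φ α β J A B z
        + ε ^ 2 * (α * emPairing Φ B B z * sqrtG Φ z) := by
  simp only [lagrangian_eq, firstVariation, emPairing_add_left hΩ hΦ hA hB hz,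
    emPairing_add_right hΩ hΦ hA hB hz, emPairing_symm hΩ hΦ hz (A := A) (B := B), mul_add,
    Finset.sum_add_distrib, mul_left_comm _ ε, ← Finset.mul_sum]
  ring

end Geometry


/-! ### First variation, integration by parts and the fundamental lemma -/

section Variation

variable {Ω K : Set Coord} {Φ : Coord → ℝ} {z : Coord} {J A η : Fin 4 → Coord → ℝ}

/-- The Euler–Lagrange density of the action. -/
def eulerLagrange (Φ : Coord → ℝ) (α β : ℝ) (J A : Fin 4 → Coord → ℝ) (i : Fin 4) (z : Coord) :
    ℝ :=
  4 * α * (((∑ j, deltaX Φ j (fun w => emFUp Φ A i j w * sqrtG Φ w) z)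
        - ∑ j, ∑ a, emFUp Φ A i j z * dY a (cartanN Φ a j) z * sqrtG Φ z)
      + ∑ a, dY a (fun w => emFtUp Φ A i a w * sqrtG Φ w) z)
    - β * (J i z * sqrtG Φ z)

theorem eulerLagrange_eq_zero_iff {α β : ℝ} (hα : α ≠ 0) (hG : sqrtG Φ z ≠ 0) (i : Fin 4) :
    eulerLagrange Φ α β J A i z = 0 ↔ maxwellLHS Φ A i z = β / (4 * α) * J i z := by
  have h : eulerLagrange Φ α β J A i z
      = 4 * α * sqrtG Φ z * (maxwellLHS Φ A i z - β / (4 * α) * J i z) := by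
    rw [eulerLagrange, maxwellLHS]
    -- The double sum contains `sqrtG`; as an atom it is left alone when denominators are cleared.
    generalize ∑ j, ∑ a, emFUp Φ A i j z * dY a (cartanN Φ a j) z * sqrtG Φ z = S
    field_simp
  rw [h, mul_eq_zero, sub_eq_zero]
  simp [hα, hG]

theorem contDiffOn_eulerLagrange (hΩ : IsOpen Ω) (hΦ : ContDiffOn ℝ ∞ Φ Ω)
    (hdet : ∀ w ∈ Ω, (metric Φ w).det ≠ 0) (hJ : ∀ i, ContDiffOn ℝ ∞ (J i) Ω)
    (hA : ∀ i, ContDiffOn ℝ ∞ (A i) Ω) (α β : ℝ) (i : Fin 4) :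
    ContDiffOn ℝ ∞ (eulerLagrange Φ α β J A i) Ω := by
  have hG := contDiffOn_sqrtG hΩ hΦ hdet
  have hp := fun j => contDiffOn_emFUp hΩ hΦ hdet hA i j
  have hq := fun a => contDiffOn_emFtUp hΩ hΦ hdet hA i a
  exact (contDiffOn_const.mul (((ContDiffOn.sum fun j _ =>
      contDiffOn_deltaX hΩ hΦ hdet ((hp j).mul hG) j).sub
    (ContDiffOn.sum fun j _ => ContDiffOn.sum fun a _ =>
      ((hp j).mul (contDiffOn_dY hΩ (contDiffOn_cartanN hΩ hΦ hdet a j) a)).mul hG)).add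
    (ContDiffOn.sum fun a _ => contDiffOn_dY hΩ ((hq a).mul hG) a))).sub
    (contDiffOn_const.mul ((hJ i).mul hG))

/-- Integration by parts for `δ_j`, before integration. -/
theorem mul_deltaX_eq (hΩ : IsOpen Ω) (hΦ : ContDiffOn ℝ ∞ Φ Ω)
    (hdet : ∀ w ∈ Ω, (metric Φ w).det ≠ 0) {p f : Coord → ℝ} (hp : ContDiffOn ℝ ∞ p Ω)
    (hf : ContDiffOn ℝ ∞ f Ω) (hz : z ∈ Ω) (j : Fin 4) :
    p z * deltaX Φ j f z
      = dX j (fun w => p w * f w) z - ∑ a, dY a (fun w => cartanN Φ a j w * (p w * f w)) z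
        - (deltaX Φ j p z - ∑ a, p z * dY a (cartanN Φ a j) z) * f z := by
  have dp := differentiableAt_of_contDiffOn hΩ hp hz
  have df := differentiableAt_of_contDiffOn hΩ hf hz
  have dN := fun a => differentiableAt_of_contDiffOn hΩ (contDiffOn_cartanN hΩ hΦ hdet a j) hz
  have dpf : DifferentiableAt ℝ (fun w => p w * f w) z := dp.mul df
  -- By Leibniz, $\partial_a(N^a{}_jpf)$ contributes the divergence of $N$ besides
  -- $N^a{}_j\partial_a(pf)$; the last sum compensates for it.
  simp only [deltaX, dX_mul j dp df, dY_mul _ (dN _) dpf, dY_mul _ dp df, Fin.sum_univ_four]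
  ring

/-- `½ F_ij[η] F^{ij}[A] = - F^{ij}[A] δ_j η_i`. -/
theorem sum_emF_mul_emFUp (hΩ : IsOpen Ω) (hΦ : ContDiffOn ℝ ∞ Φ Ω) (hz : z ∈ Ω) :
    ∑ i, ∑ j, emF Φ η i j z * emFUp Φ A i j z
      = -2 * ∑ i, ∑ j, emFUp Φ A i j z * deltaX Φ j (η i) z := by
  have h1 : ∑ i, ∑ j, deltaX Φ i (η j) z * emFUp Φ A i j z
      = - ∑ i, ∑ j, emFUp Φ A i j z * deltaX Φ j (η i) z := by
    rw [Finset.sum_comm]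
    simp only [← Finset.sum_neg_distrib]
    refine Finset.sum_congr rfl fun i _ => Finset.sum_congr rfl fun j _ => ?_
    rw [emFUp_antisymm j i]
    ring
  simp only [emF_eq hΩ hΦ hz, sub_mul, Finset.sum_sub_distrib,
    mul_comm (deltaX Φ _ _ z)] at h1 ⊢
  rw [h1]
  ring

/-- `V` and `Y` stand for total derivatives, `W` and `Z` for the coefficients of `e = η`. The
horizontal factor 2 comes from the antisymmetry of $F$, the vertical one from the weight 2 in the
Lagrangian; with the $2\alpha$ of the polarized quadratic form both give $4\alpha$. -/
theorem sum_collect (V W Y Z : Fin 4 → Fin 4 → ℝ) (e c : Fin 4 → ℝ) (α : ℝ) :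
    2 * α * (-2 * (∑ i, ∑ j, (V i j - W i j * e i)) + 2 * ∑ i, ∑ a, (-Y i a + Z i a * e i))
        - ∑ i, c i * e i
      = (∑ i, e i * (4 * α * (∑ j, W i j + ∑ a, Z i a) - c i))
        - 4 * α * ((∑ i, ∑ j, V i j) + ∑ i, ∑ a, Y i a) := by
  simp only [Fin.sum_univ_four]
  ring

/-- The first variation is the Euler–Lagrange expression up to a divergence. -/
theorem firstVariation_eq (hΩ : IsOpen Ω) (hΦ : ContDiffOn ℝ ∞ Φ Ω)
    (hdet : ∀ w ∈ Ω, (metric Φ w).det ≠ 0) (hA : ∀ i, ContDiffOn ℝ ∞ (A i) Ω)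
    (hη : ∀ i, ContDiffOn ℝ ∞ (η i) Ω) (hz : z ∈ Ω) (α β : ℝ) :
    firstVariation Φ α β J A η z
      = (∑ i, η i z * eulerLagrange Φ α β J A i z)
        - 4 * α * ((∑ i, ∑ j, (dX j (fun w => emFUp Φ A i j w * sqrtG Φ w * η i w) z
            - ∑ a, dY a (fun w => cartanN Φ a j w * (emFUp Φ A i j w * sqrtG Φ w * η i w)) z))
          + ∑ i, ∑ a, dY a (fun w => emFtUp Φ A i a w * sqrtG Φ w * η i w) z) := by
  have hG := contDiffOn_sqrtG hΩ hΦ hdet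
  have hp := fun i j => (contDiffOn_emFUp hΩ hΦ hdet hA i j).mul hG
  have hq := fun i a => (contDiffOn_emFtUp hΩ hΦ hdet hA i a).mul hG
  have h1 : ∀ i j, (emFUp Φ A i j z * deltaX Φ j (η i) z) * sqrtG Φ z
      = dX j (fun w => emFUp Φ A i j w * sqrtG Φ w * η i w) z
        - ∑ a, dY a (fun w => cartanN Φ a j w * (emFUp Φ A i j w * sqrtG Φ w * η i w)) z
        - (deltaX Φ j (fun w => emFUp Φ A i j w * sqrtG Φ w) z
          - ∑ a, emFUp Φ A i j z * dY a (cartanN Φ a j) z * sqrtG Φ z) * η i z := fun i j => by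
    rw [mul_right_comm, mul_deltaX_eq hΩ hΦ hdet (hp i j) (hη i) hz j]
    simp only [mul_right_comm _ (sqrtG Φ z)]
  have h2 : ∀ i a, (emFt η i a z * emFtUp Φ A i a z) * sqrtG Φ z
      = - dY a (fun w => emFtUp Φ A i a w * sqrtG Φ w * η i w) z
        + dY a (fun w => emFtUp Φ A i a w * sqrtG Φ w) z * η i z := fun i a => by
    rw [dY_mul a (differentiableAt_of_contDiffOn hΩ (hq i a) hz)
      (differentiableAt_of_contDiffOn hΩ (hη i) hz), emFt]
    ring
  have h3 : emPairing Φ η A z * sqrtG Φ z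
      = -2 * (∑ i, ∑ j, (emFUp Φ A i j z * deltaX Φ j (η i) z) * sqrtG Φ z)
        + 2 * ∑ i, ∑ a, (emFt η i a z * emFtUp Φ A i a z) * sqrtG Φ z := by
    simp only [emPairing, sum_emF_mul_emFUp hΩ hΦ hz, ← Finset.sum_mul]
    ring
  have h4 : firstVariation Φ α β J A η z
      = 2 * α * (emPairing Φ η A z * sqrtG Φ z) - ∑ i, β * (J i z * sqrtG Φ z) * η i z := by
    simp only [firstVariation, sub_mul, Finset.sum_mul, Finset.mul_sum]
    congr 1
    · ring
    · exact Finset.sum_congr rfl fun i _ => by ring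
  rw [h4, h3]
  simp only [h1, h2, eulerLagrange, ← Finset.sum_sub_distrib]
  exact sum_collect _ _ _ _ _ _ α

theorem integrableOn_firstVariation
    (hΩ : IsOpen Ω) (hΦ : ContDiffOn ℝ ∞ Φ Ω) (hdet : ∀ w ∈ Ω, (metric Φ w).det ≠ 0)
    (hJ : ∀ i, ContDiffOn ℝ ∞ (J i) Ω) (hA : ∀ i, ContDiffOn ℝ ∞ (A i) Ω)
    (hη : ∀ i, ContDiffOn ℝ ∞ (η i) Ω) (hK : IsCompact K) (hKΩ : K ⊆ Ω)
    (h0 : ∀ i, ∀ w ∈ Ω, w ∉ K → η i w = 0)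
    (α β : ℝ) : IntegrableOn (firstVariation Φ α β J A η) Ω := by
  refine integrableOn_of_eq_zero_off_compact hΩ ?_ hK hKΩ fun w hw hwK => ?_
  · exact ((contDiffOn_const.mul (contDiffOn_emPairing hΩ hΦ hdet hη hA)).sub
      (contDiffOn_const.mul (ContDiffOn.sum fun k _ => (hJ k).mul (hη k)))).mul
      (contDiffOn_sqrtG hΩ hΦ hdet) |>.continuousOn
  · simp [firstVariation, emPairing_eq_zero_off_compact hΩ hΦ hK h0 hw hwK, h0 _ w hw hwK]

theorem setIntegral_firstVariation
    (hΩ : IsOpen Ω) (hΦ : ContDiffOn ℝ ∞ Φ Ω) (hdet : ∀ w ∈ Ω, (metric Φ w).det ≠ 0)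
    (hJ : ∀ i, ContDiffOn ℝ ∞ (J i) Ω) (hA : ∀ i, ContDiffOn ℝ ∞ (A i) Ω)
    (hη : ∀ i, ContDiffOn ℝ ∞ (η i) Ω) (hK : IsCompact K) (hKΩ : K ⊆ Ω)
    (h0 : ∀ i, ∀ w ∈ Ω, w ∉ K → η i w = 0)
    (α β : ℝ) :
    ∫ w in Ω, firstVariation Φ α β J A η w
      = ∫ w in Ω, ∑ i, η i w * eulerLagrange Φ α β J A i w := by
  have hG := contDiffOn_sqrtG hΩ hΦ hdet
  -- Every divergence term is a derivative of a smooth function times some `η i`, so it vanishes off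
  -- `K`.
  have key : ∀ (f : Coord → ℝ) (i : Fin 4), ContDiffOn ℝ ∞ f Ω → ∀ v : Coord,
      IntegrableOn (fun w => fderiv ℝ (fun u => f u * η i u) w v) Ω ∧
        ∫ w in Ω, fderiv ℝ (fun u => f u * η i u) w v = 0 := fun f i hf v => by
    have hz : ∀ w ∈ Ω, w ∉ K → f w * η i w = 0 := fun w hw hwK => by simp [h0 i w hw hwK]
    refine ⟨integrableOn_of_eq_zero_off_compact hΩ
      (contDiffOn_fderiv_apply hΩ (hf.mul (hη i)) v).continuousOn hK hKΩ fun w hw hwK => ?_,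
      setIntegral_fderiv_eq_zero hΩ (hf.mul (hη i)) hK hKΩ hz v⟩
    rw [fderiv_eq_zero_off_compact hΩ hK hz hw hwK]
    rfl
  have kX : ∀ i j, IntegrableOn
      (dX j (fun w => emFUp Φ A i j w * sqrtG Φ w * η i w)) Ω ∧
      ∫ w in Ω, dX j (fun w => emFUp Φ A i j w * sqrtG Φ w * η i w) w = 0 := fun i j =>
    key _ i ((contDiffOn_emFUp hΩ hΦ hdet hA i j).mul hG) _
  have kN : ∀ i j a, IntegrableOn
      (dY a (fun w => cartanN Φ a j w * (emFUp Φ A i j w * sqrtG Φ w * η i w))) Ω ∧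
      ∫ w in Ω, dY a (fun w => cartanN Φ a j w * (emFUp Φ A i j w * sqrtG Φ w * η i w)) w = 0 :=
    fun i j a => by
    have := key _ i ((contDiffOn_cartanN hΩ hΦ hdet a j).mul
      ((contDiffOn_emFUp hΩ hΦ hdet hA i j).mul hG)) (0, EuclideanSpace.single a 1)
    simp only [mul_assoc] at this ⊢
    exact this
  have kY : ∀ i a, IntegrableOn
      (dY a (fun w => emFtUp Φ A i a w * sqrtG Φ w * η i w)) Ω ∧
      ∫ w in Ω, dY a (fun w => emFtUp Φ A i a w * sqrtG Φ w * η i w) w = 0 := fun i a =>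
    key _ i ((contDiffOn_emFtUp hΩ hΦ hdet hA i a).mul hG) _
  have hE : IntegrableOn (fun w => ∑ i, η i w * eulerLagrange Φ α β J A i w) Ω := by
    refine integrableOn_of_eq_zero_off_compact hΩ ?_ hK hKΩ fun w hw hwK => ?_
    · exact (ContDiffOn.sum fun i _ => (hη i).mul
        (contDiffOn_eulerLagrange hΩ hΦ hdet hJ hA α β i)).continuousOn
    · simp [h0 _ w hw hwK]
  have i1 : ∀ i j, IntegrableOn (fun w =>
      (dX j (fun w => emFUp Φ A i j w * sqrtG Φ w * η i w) w
      - ∑ a, dY a (fun w => cartanN Φ a j w * (emFUp Φ A i j w * sqrtG Φ w * η i w)) w)) Ω :=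
    fun i j => (kX i j).1.sub (integrable_finsetSum _ fun a _ => (kN i j a).1)
  set D₁ : Coord → ℝ := fun w => ∑ i, ∑ j,
    (dX j (fun w => emFUp Φ A i j w * sqrtG Φ w * η i w) w
      - ∑ a, dY a (fun w => cartanN Φ a j w * (emFUp Φ A i j w * sqrtG Φ w * η i w)) w) with hD₁
  set D₂ : Coord → ℝ := fun w => ∑ i, ∑ a,
    dY a (fun w => emFtUp Φ A i a w * sqrtG Φ w * η i w) w with hD₂
  have I1 : IntegrableOn D₁ Ω :=
    integrable_finsetSum _ fun i _ => integrable_finsetSum _ fun j _ => i1 i j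
  have I2 : IntegrableOn D₂ Ω :=
    integrable_finsetSum _ fun i _ => integrable_finsetSum _ fun a _ => (kY i a).1
  have z1 : ∫ w in Ω, D₁ w = 0 := by
    rw [hD₁, integral_finsetSum _ fun i _ => integrable_finsetSum _ fun j _ => i1 i j]
    refine Finset.sum_eq_zero fun i _ => ?_
    rw [integral_finsetSum _ fun j _ => i1 i j]
    refine Finset.sum_eq_zero fun j _ => ?_
    rw [integral_sub (kX i j).1 (integrable_finsetSum _ fun a _ => (kN i j a).1), (kX i j).2,
      integral_finsetSum _ fun a _ => (kN i j a).1]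
    simp only [(kN i j _).2, Finset.sum_const_zero, sub_zero]
  have z2 : ∫ w in Ω, D₂ w = 0 := by
    rw [hD₂, integral_finsetSum _ fun i _ => integrable_finsetSum _ fun a _ => (kY i a).1]
    refine Finset.sum_eq_zero fun i _ => ?_
    rw [integral_finsetSum _ fun a _ => (kY i a).1]
    simp only [(kY i _).2, Finset.sum_const_zero]
  have I12 : IntegrableOn (fun w => 4 * α * (D₁ w + D₂ w)) Ω := (I1.add I2).const_mul _
  rw [setIntegral_congr_fun hΩ.measurableSet fun w hw =>
    firstVariation_eq (J := J) hΩ hΦ hdet hA hη hw α β, integral_sub hE I12,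
    integral_const_mul, integral_add I1 I2, z1, z2]
  ring

/-- The action is differentiable along a compactly supported variation, and its derivative is the
integral of the Euler–Lagrange density against the variation. -/
theorem hasDerivAt_action
    (hΩ : IsOpen Ω) (hΦ : ContDiffOn ℝ ∞ Φ Ω) (hdet : ∀ w ∈ Ω, (metric Φ w).det ≠ 0)
    (hJ : ∀ i, ContDiffOn ℝ ∞ (J i) Ω) (hA : ∀ i, ContDiffOn ℝ ∞ (A i) Ω)
    (hη : ∀ i, ContDiffOn ℝ ∞ (η i) Ω) (hK : IsCompact K) (hKΩ : K ⊆ Ω)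
    (h0 : ∀ i, ∀ w ∈ Ω, w ∉ K → η i w = 0)
    (α β : ℝ) (hI : IntegrableOn (lagrangian Φ α β J A) Ω) :
    HasDerivAt (fun ε : ℝ => action Φ Ω α β J (fun k w => A k w + ε * η k w))
      (∫ w in Ω, ∑ i, η i w * eulerLagrange Φ α β J A i w) 0 := by
  have hP := integrableOn_firstVariation hΩ hΦ hdet hJ hA hη hK hKΩ h0 α β
  have hQ : IntegrableOn (fun w => α * emPairing Φ η η w * sqrtG Φ w) Ω := by
    refine integrableOn_of_eq_zero_off_compact hΩ ?_ hK hKΩ fun w hw hwK => ?_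
    · exact ((contDiffOn_const.mul (contDiffOn_emPairing hΩ hΦ hdet hη hη)).mul
        (contDiffOn_sqrtG hΩ hΦ hdet)).continuousOn
    · simp [emPairing_eq_zero_off_compact hΩ hΦ hK h0 hw hwK]
  -- Absolute convergence of $I(A)$ splits off the constant term; the other two integrands vanish
  -- off `K`.
  have hexp : ∀ ε : ℝ, action Φ Ω α β J (fun k w => A k w + ε * η k w)
      = action Φ Ω α β J A + ε * (∫ w in Ω, firstVariation Φ α β J A η w)
        + ε ^ 2 * ∫ w in Ω, α * emPairing Φ η η w * sqrtG Φ w := fun ε => by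
    have h1 : IntegrableOn (fun w => lagrangian Φ α β J A w
      + ε * firstVariation Φ α β J A η w) Ω := hI.add (hP.const_mul ε)
    rw [action, setIntegral_congr_fun hΩ.measurableSet fun w hw =>
      lagrangian_add_const_mul hΩ hΦ hA hη hw α β J ε,
      integral_add h1 (hQ.const_mul _), integral_add hI (hP.const_mul ε),
      integral_const_mul, integral_const_mul, action]
  rw [← setIntegral_firstVariation hΩ hΦ hdet hJ hA hη hK hKΩ h0 α β, funext hexp]
  have := (((hasDerivAt_id (0 : ℝ)).mul_const (∫ w in Ω, firstVariation Φ α β J A η w)).const_add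
    (action Φ Ω α β J A)).add (((hasDerivAt_id (0 : ℝ)).pow 2).mul_const
      (∫ w in Ω, α * emPairing Φ η η w * sqrtG Φ w))
  exact this.congr_deriv (by simp)

/-- Smooth densities whose integrals against compactly supported covector fields vanish are zero. -/
theorem eulerLagrange_eq_zero_of_forall_integral
    (hΩ : IsOpen Ω) (hΦ : ContDiffOn ℝ ∞ Φ Ω) (hdet : ∀ w ∈ Ω, (metric Φ w).det ≠ 0)
    (hJ : ∀ i, ContDiffOn ℝ ∞ (J i) Ω) (hA : ∀ i, ContDiffOn ℝ ∞ (A i) Ω)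
    (α β : ℝ)
    (h : ∀ (i : Fin 4) (φ : Coord → ℝ), ContDiff ℝ ∞ φ → HasCompactSupport φ → tsupport φ ⊆ Ω →
      ∫ w in Ω, φ w * eulerLagrange Φ α β J A i w = 0) (i : Fin 4) (hz : z ∈ Ω) :
    eulerLagrange Φ α β J A i z = 0 := by
  have hc := (contDiffOn_eulerLagrange hΩ hΦ hdet hJ hA α β i).continuousOn
  -- The fundamental lemma gives vanishing almost everywhere; continuity makes it hold everywhere on
  -- `Ω`.
  have hae := hΩ.ae_eq_zero_of_integral_contDiff_smul_eq_zero (μ := (volume : Measure Coord))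
    (hc.locallyIntegrableOn hΩ.measurableSet) fun φ hφ hφc hφs => by
      rw [← h i φ hφ hφc hφs, setIntegral_eq_integral_of_forall_compl_eq_zero]
      · rfl
      · intro w hw
        rw [image_eq_zero_of_notMem_tsupport fun hw' => hw (hφs hw'), zero_mul]
  have hae' : eulerLagrange Φ α β J A i =ᵐ[(volume : Measure Coord).restrict Ω] fun _ => 0 :=
    (ae_restrict_iff' hΩ.measurableSet).2 hae
  exact Measure.eqOn_open_of_ae_eq hae' hΩ hc continuousOn_const hz

end Variation


/-! ### Passage between `TM` and its induced chart -/

section Transfer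

variable {M : Type*} [TopologicalSpace M] [ChartedSpace E4 M]

/-- The chart of `TM` induced by a chart `e` of `M`. -/
def tangentCoord (e : OpenPartialHomeomorph M E4) (v : TangentBundle (𝓡 4) M) : Coord :=
  (e v.proj, mfderiv (𝓡 4) (𝓡 4) e v.proj v.2)

variable {e : OpenPartialHomeomorph M E4} {D : Set (TangentBundle (𝓡 4) M)}

theorem mdifferentiable_of_mem_maximalAtlas (he : e ∈ IsManifold.maximalAtlas (𝓡 4) ∞ M) :
    e.MDifferentiable (𝓡 4) (𝓡 4) :=
  ⟨(contMDiffOn_of_mem_maximalAtlas he).mdifferentiableOn (by simp),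
    (contMDiffOn_symm_of_mem_maximalAtlas he).mdifferentiableOn (by simp)⟩

theorem mfderiv_symm_apply_mfderiv (he : e ∈ IsManifold.maximalAtlas (𝓡 4) ∞ M) {x : M}
    (hx : x ∈ e.source) (w : TangentSpace (𝓡 4) x) :
    mfderiv (𝓡 4) (𝓡 4) e.symm (e x) (mfderiv (𝓡 4) (𝓡 4) e x w) = w :=
  DFunLike.congr_fun ((mdifferentiable_of_mem_maximalAtlas he).symm_comp_deriv hx) w

theorem mfderiv_apply_mfderiv_symm (he : e ∈ IsManifold.maximalAtlas (𝓡 4) ∞ M) {x : E4}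
    (hx : x ∈ e.target) (w : E4) :
    mfderiv (𝓡 4) (𝓡 4) e (e.symm x) (mfderiv (𝓡 4) (𝓡 4) e.symm x w) = w :=
  DFunLike.congr_fun ((mdifferentiable_of_mem_maximalAtlas he).comp_symm_deriv hx) w

theorem tangentPoint_tangentCoord (he : e ∈ IsManifold.maximalAtlas (𝓡 4) ∞ M)
    {v : TangentBundle (𝓡 4) M} (hv : v.proj ∈ e.source) :
    tangentPoint e (tangentCoord e v) = v := by
  obtain ⟨x, w⟩ := v
  exact Bundle.TotalSpace.ext (e.left_inv hv) (heq_of_eq (mfderiv_symm_apply_mfderiv he hv w))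

theorem tangentCoord_tangentPoint (he : e ∈ IsManifold.maximalAtlas (𝓡 4) ∞ M)
    {z : Coord} (hz : z.1 ∈ e.target) : tangentCoord e (tangentPoint e z) = z :=
  Prod.ext (e.right_inv hz) (mfderiv_apply_mfderiv_symm he hz z.2)

theorem tangentCoord_mem_coordDomain (he : e ∈ IsManifold.maximalAtlas (𝓡 4) ∞ M)
    {v : TangentBundle (𝓡 4) M} (hv : v.proj ∈ e.source) (hvD : v ∈ D) :
    tangentCoord e v ∈ coordDomain e D :=
  ⟨e.map_source hv, by rwa [tangentPoint_tangentCoord he hv]⟩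

open Classical in
/-- The horizontal 1-form `φ(x, y) dxⁱ`, extended by zero off `D`. -/
def coordForm (e : OpenPartialHomeomorph M E4) (D : Set (TangentBundle (𝓡 4) M)) (i : Fin 4)
    (φ : Coord → ℝ) : HorizontalForm M := fun v =>
  if v ∈ D then
    φ (tangentCoord e v) • (EuclideanSpace.proj i : E4 →L[ℝ] ℝ).comp
      (mfderiv (𝓡 4) (𝓡 4) e v.proj : TangentSpace (𝓡 4) v.proj →L[ℝ] E4)
  else 0

theorem formComp_coordForm (he : e ∈ IsManifold.maximalAtlas (𝓡 4) ∞ M) (i k : Fin 4)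
    (φ : Coord → ℝ) {z : Coord} (hz : z ∈ coordDomain e D) :
    formComp e (coordForm e D i φ) k z = if k = i then φ z else 0 := by
  have h : formComp e (coordForm e D i φ) k z = φ (tangentCoord e (tangentPoint e z)) *
      (EuclideanSpace.proj i : E4 →L[ℝ] ℝ) (mfderiv (𝓡 4) (𝓡 4) e (e.symm z.1)
        (mfderiv (𝓡 4) (𝓡 4) e.symm z.1 (EuclideanSpace.single k 1 : E4))) := by
    rw [formComp, coordForm, if_pos hz.2]
    rfl
  rw [h, tangentCoord_tangentPoint he hz.1]
  have h2 := mfderiv_apply_mfderiv_symm he hz.1 (EuclideanSpace.single k 1)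
  refine (congrArg (fun w : E4 => φ z * (EuclideanSpace.proj i : E4 →L[ℝ] ℝ) w) h2).trans ?_
  by_cases hk : k = i
  · simp [hk]
  · simp [hk, Ne.symm hk]

variable [IsManifold (𝓡 4) ∞ M]

/-- Under the identification of $TE$ with $E\times E$, for $E$ the model space, this map is the
tangent map of `e.symm`. -/
theorem contMDiffOn_tangentPoint (he : e ∈ IsManifold.maximalAtlas (𝓡 4) ∞ M) :
    ContMDiffOn 𝓘(ℝ, Coord) (𝓡 4).tangent ∞ (tangentPoint e) {z | z.1 ∈ e.target} := by
  have : IsManifold (𝓡 4) 1 M := IsManifold.of_le (n := ∞) (by simp)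
  have h1 : ContMDiffOn (𝓡 4).tangent (𝓡 4).tangent ∞
      (tangentMapWithin (𝓡 4) (𝓡 4) e.symm e.target)
      (Bundle.TotalSpace.proj ⁻¹' e.target) :=
    (contMDiffOn_symm_of_mem_maximalAtlas he).contMDiffOn_tangentMapWithin (by simp)
      e.open_target.uniqueMDiffOn
  have h2 : ContMDiff 𝓘(ℝ, Coord) (𝓡 4).tangent ∞
      (fun z : Coord => (⟨z.1, z.2⟩ : TangentBundle (𝓡 4) E4)) := by
    rw [modelWithCornersSelf_prod]
    exact contMDiff_tangentBundleModelSpaceHomeomorph_symm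
  refine (h1.comp (h2.contMDiffOn (s := {z : Coord | z.1 ∈ e.target}))
    fun z (hz : z.1 ∈ e.target) => hz).congr fun z hz => ?_
  simp only [Function.comp, tangentMapWithin, tangentPoint]
  rw [mfderivWithin_of_isOpen e.open_target hz]

/-- Needed to carry compact supports in `TM` to compact sets of coordinates. -/
theorem continuousOn_tangentCoord (he : e ∈ IsManifold.maximalAtlas (𝓡 4) ∞ M) :
    ContinuousOn (tangentCoord e) {v | v.proj ∈ e.source} := by
  have : IsManifold (𝓡 4) 1 M := IsManifold.of_le (n := ∞) (by simp)
  have h1 : ContinuousOn (tangentMapWithin (𝓡 4) (𝓡 4) e e.source)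
      (Bundle.TotalSpace.proj ⁻¹' e.source) :=
    (contMDiffOn_of_mem_maximalAtlas he).continuousOn_tangentMapWithin (by simp)
      e.open_source.uniqueMDiffOn
  refine ((tangentBundleModelSpaceHomeomorph (𝓡 4)).continuous.comp_continuousOn h1).congr
    fun v hv => ?_
  rw [tangentBundleModelSpaceHomeomorph_coe]
  simp only [Function.comp, tangentMapWithin, tangentCoord]
  rw [mfderivWithin_of_isOpen e.open_source hv]
  rfl

theorem isOpen_coordDomain (he : e ∈ IsManifold.maximalAtlas (𝓡 4) ∞ M) (hD : IsOpen D) :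
    IsOpen (coordDomain e D) :=
  (contMDiffOn_tangentPoint he).continuousOn.isOpen_inter_preimage
    (e.open_target.preimage continuous_fst) hD

theorem contDiffOn_coordFun (he : e ∈ IsManifold.maximalAtlas (𝓡 4) ∞ M)
    {f : TangentBundle (𝓡 4) M → ℝ} (hf : ContMDiffOn (𝓡 4).tangent 𝓘(ℝ, ℝ) ∞ f D) :
    ContDiffOn ℝ ∞ (coordFun e f) (coordDomain e D) :=
  contMDiffOn_iff_contDiffOn.1 <|
    hf.comp ((contMDiffOn_tangentPoint he).mono fun _ hz => hz.1) fun _ hz => hz.2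

end Transfer

end FinslerEM

end

/-! ### The variational characterization of Maxwell's equation -/

open scoped Manifold ContDiff in
theorem mainTheorem5 {M : Type*} [TopologicalSpace M] [ChartedSpace FinslerEM.E4 M]
    [IsManifold (𝓡 4) ∞ M] (ℱ : FinslerEM.PseudoFinsler M)
    (e : OpenPartialHomeomorph M FinslerEM.E4) (he : e ∈ IsManifold.maximalAtlas (𝓡 4) ∞ M)
    (D : Set (TangentBundle (𝓡 4) M)) (hD : IsOpen D) (hD_cone : D ⊆ ℱ.cone)
    (hD_chart : ∀ v ∈ D, v.proj ∈ e.source)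
    (α β : ℝ) (hα : α ≠ 0)
    (J : FinslerEM.HorizontalField M) (hJ : FinslerEM.SmoothFieldOn e J D)
    (A : FinslerEM.HorizontalForm M) (hA : FinslerEM.SmoothFormOn e A D)
    (hI : MeasureTheory.IntegrableOn
      (FinslerEM.lagrangian (FinslerEM.coordFun e ℱ.toFun) α β
        (FinslerEM.fieldComp e J) (FinslerEM.formComp e A))
      (FinslerEM.coordDomain e D)) :
    FinslerEM.IsStationary ℱ e D α β J A ↔
      ∀ i : Fin 4, ∀ z ∈ FinslerEM.coordDomain e D,
        FinslerEM.maxwellLHS (FinslerEM.coordFun e ℱ.toFun) (FinslerEM.formComp e A) i z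
          = β / (4 * α) * FinslerEM.fieldComp e J i z := by
  open FinslerEM in
  have hΩ : IsOpen (coordDomain e D) := isOpen_coordDomain he hD
  have hΦ : ContDiffOn ℝ ∞ (coordFun e ℱ.toFun) (coordDomain e D) :=
    contDiffOn_coordFun he (ℱ.smooth.mono hD_cone)
  have hdet : ∀ z ∈ coordDomain e D, (metric (coordFun e ℱ.toFun) z).det ≠ 0 := fun z hz =>
    ℱ.nondegenerate e he z ⟨hz.1, hD_cone hz.2⟩
  have hderiv : ∀ η : HorizontalForm M, SmoothFormOn e η D →
      (∃ K : Set (TangentBundle (𝓡 4) M), IsCompact K ∧ K ⊆ D ∧ ∀ v, v ∉ K → η v = 0) →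
      HasDerivAt (fun ε : ℝ => emAction ℱ e D α β J (fun v => A v + ε • η v))
        (∫ w in coordDomain e D, ∑ i, formComp e η i w *
          eulerLagrange (coordFun e ℱ.toFun) α β (fieldComp e J) (formComp e A) i w) 0 := by
    rintro η hη ⟨K, hK, hKD, hK0⟩
    -- `M` is not assumed Hausdorff, so `K` need not be closed in `TM`; its coordinate image is
    -- compact and therefore closed.
    refine hasDerivAt_action (K := tangentCoord e '' K) hΩ hΦ hdet hJ hA hη
      (hK.image_of_continuousOn
        ((continuousOn_tangentCoord he).mono fun v hv => hD_chart v (hKD hv)))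
      ?_ ?_ α β hI
    · rintro _ ⟨v, hv, rfl⟩
      exact tangentCoord_mem_coordDomain he (hD_chart v (hKD hv)) (hKD hv)
    · intro i w hw hwK
      have hv : tangentPoint e w ∉ K := fun h =>
        hwK ⟨_, h, tangentCoord_tangentPoint he hw.1⟩
      rw [formComp, hK0 _ hv]
      rfl
  have hEL : (∀ i : Fin 4, ∀ z ∈ coordDomain e D,
      maxwellLHS (coordFun e ℱ.toFun) (formComp e A) i z = β / (4 * α) * fieldComp e J i z) ↔
      ∀ i : Fin 4, ∀ z ∈ coordDomain e D,
        eulerLagrange (coordFun e ℱ.toFun) α β (fieldComp e J) (formComp e A) i z = 0 :=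
    forall_congr' fun i => forall₂_congr fun z hz =>
      (eulerLagrange_eq_zero_iff hα (sqrtG_pos (hdet z hz)).ne' i).symm
  rw [hEL]
  constructor
  · intro hst i z hz
    refine eulerLagrange_eq_zero_of_forall_integral hΩ hΦ hdet hJ hA α β
      (fun i φ hφ hφc hφs => ?_) i hz
    have hs : SmoothFormOn e (coordForm e D i φ) D := fun k => by
      refine ContDiffOn.congr (f := fun z => if k = i then φ z else 0) ?_ fun z hz =>
        formComp_coordForm he i k φ hz
      by_cases hk : k = i
      · simpa [hk] using hφ.contDiffOn
      · simpa [hk] using contDiffOn_const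
    have hc : ∃ K : Set (TangentBundle (𝓡 4) M),
        IsCompact K ∧ K ⊆ D ∧ ∀ v, v ∉ K → coordForm e D i φ v = 0 := by
      refine ⟨tangentPoint e '' tsupport φ, hφc.isCompact.image_of_continuousOn
        ((contMDiffOn_tangentPoint he).continuousOn.mono fun w hw => (hφs hw).1), ?_, ?_⟩
      · rintro _ ⟨w, hw, rfl⟩
        exact (hφs hw).2
      · intro v hv
        by_cases hvD : v ∈ D
        · have hnot : tangentCoord e v ∉ tsupport φ := fun h =>
            hv ⟨_, h, tangentPoint_tangentCoord he (hD_chart v hvD)⟩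
          rw [coordForm, if_pos hvD, image_eq_zero_of_notMem_tsupport hnot, zero_smul]
        · rw [coordForm, if_neg hvD]
    -- Stationarity and `hderiv` give two values for the same derivative, so the integral is zero;
    -- for `φ dxⁱ` its sum has only the `i`-th term.
    rw [← (hderiv _ hs hc).unique (hst _ hs hc)]
    refine MeasureTheory.setIntegral_congr_fun hΩ.measurableSet fun w hw => ?_
    simp [formComp_coordForm he i _ φ hw]
  · intro h η hη hK
    refine (hderiv η hη hK).congr_deriv (MeasureTheory.setIntegral_eq_zero_of_forall_eq_zero
      fun w hw => Finset.sum_eq_zero fun i _ => by rw [h i w hw, mul_zero])
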